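/- **Setting.** A storage graph $\mathcal G=((\lambda_1,\dots,\lambda_N),\mathcal E)$ consists of relative sizes $\lambda_n\ge 0$ of $N$ storage nodes $Q_1,\dots,Q_N$ and a set $\mathcal E$ of subsets of $[N]=\{1,\dots,N\}$ (the decoding sets). All quantum systems are finite dimensional, and $|Q|$ is the dimension of $Q$. For integers $q\ge 2$ and $\kappa\ge 1$, the storage $(\mathcal G,q,\kappa)$ *fits* a quantum message $Q_0$ if there are quantum systems $Q_1,\dots,Q_N$ with $\log_q|Q_n|\le\kappa\lambda_n$ for all $n\in[N]$, a completely positive trace preserving (CPTP) encoding map $\mathrm{ENC}$ from $Q_0$ to $Q_1\cdots Q_N$ and, for every $e\in\mathcal E$, a CPTP decoding map $\mathrm{DEC}^e$ from $(Q_n)_{n\in e}$ to $Q_0$, such that for a reference system $R$ with $|R|=|Q_0|$, every pure state $|\varphi\rangle\langle\varphi|$ of $RQ_0$ and every $e\in\mathcal E$, $$\big(I_R\otimes(\mathrm{DEC}^e\circ \mathrm{Tr}_{(Q_n:\,n\notin e)}\circ\mathrm{ENC})\big)\big(|\varphi\rangle\langle\varphi|\big)=|\varphi\rangle\langle\varphi|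 .$$ The *capacity* $C(\mathcal G)$ is the supremum, over all integers $q\ge 2$ and $\kappa\ge 1$, of the numbers $\lambda_0$ such that $(\mathcal G,q,\kappa)$ fits some $Q_0$ of size $\log_q|Q_0|=\kappa\lambda_0$. For $K\le N$, the *MDS graph* $\mathcal M_{N,K}$ is the storage graph with sizes $(\lambda_1,\dots,\lambda_N)$ whose decoding sets are all the $K$-element subsets of $[N]$. **Theorem.** Let $K\le N$ and $2K>N$, and let $0\le\lambda_1\le\lambda_2\le\cdots\le\lambda_N$. Then $$C(\mathcal M_{N,K})=\min_{\mathcal I\subseteq[N],\ |\mathcal I|=2K-N}\ \sum_{i\in\mathcal I}\lambda_i=\lambda_1+\lambda_2+\cdots+\lambda_{2K-N}.$$ For uniform storage, i.e. $\lambda_1=\cdots=\lambda_N=1$, the capacity is $2K-N$. -/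

import Mathlib

open scoped ComplexOrder

/-- A quantum storage structure on `N` nodes: the relative sizes of the nodes, and the family of
(index sets of) decoding sets. -/
structure StorageGraph (N : ℕ) where
  /-- relative size of each storage node -/
  size : Fin N → ℝ
  /-- the hyperedges, i.e. the index sets of the decoding sets -/
  edges : Set (Finset (Fin N))

/-- The map `id_R ⊗ Φ` on matrices over a composite system: `Φ` is applied to each of the blocks
`(X (r, ·) (s, ·))`. -/
def idTensor (R : Type) {m n : Type} (Φ : Matrix m m ℂ →ₗ[ℂ] Matrix n n ℂ)
    (X : Matrix (R × m) (R × m) ℂ) : Matrix (R × n) (R × n) ℂ :=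
  Matrix.of fun x y => Φ (Matrix.of fun a b => X (x.1, a) (y.1, b)) x.2 y.2

/-- Completely positive trace preserving maps between matrix algebras. -/
def IsCPTP {m n : Type} [Fintype m] [Fintype n] (Φ : Matrix m m ℂ →ₗ[ℂ] Matrix n n ℂ) : Prop :=
  (∀ (k : ℕ) (X : Matrix (Fin k × m) (Fin k × m) ℂ),
      X.PosSemidef → (idTensor (Fin k) Φ X).PosSemidef) ∧
    ∀ X : Matrix m m ℂ, (Φ X).trace = X.trace

/-- Basis labels of the composite system formed by the nodes `i` with `p i`, where node `i` has the
Hilbert space `ℂ ^ (d i)`. -/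
abbrev SubIndex {N : ℕ} (d : Fin N → ℕ) (p : Fin N → Prop) : Type :=
  (i : {i : Fin N // p i}) → Fin (d i)

/-- The erasure channel which keeps the nodes in `e`: the partial trace over all nodes outside
`e`. -/
def eraseOutside {N : ℕ} (d : Fin N → ℕ) (e : Finset (Fin N)) :
    Matrix ((i : Fin N) → Fin (d i)) ((i : Fin N) → Fin (d i)) ℂ →ₗ[ℂ]
      Matrix (SubIndex d (· ∈ e)) (SubIndex d (· ∈ e)) ℂ where
  toFun ρ := Matrix.of fun x y => ∑ z : SubIndex d (fun i => ¬ i ∈ e),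
    ρ ((Equiv.piEquivPiSubtypeProd (· ∈ e) fun i => Fin (d i)).symm (x, z))
      ((Equiv.piEquivPiSubtypeProd (· ∈ e) fun i => Fin (d i)).symm (y, z))
  map_add' ρ σ := by
    ext x y
    simp [Finset.sum_add_distrib]
  map_smul' c ρ := by
    ext x y
    simp [Finset.mul_sum]

/-- The rank one matrix `|φ⟩⟨φ|`. -/
def pureState {m : Type} (φ : m → ℂ) : Matrix m m ℂ :=
  Matrix.vecMulVec φ (star φ)

/-- The storage `(G, q, κ)` fits a quantum message of dimension `m`: for some dimensions `d n` of
the storage nodes with `log_q (d n) ≤ κ * size n` there are a CPTP encoder and, for each decoding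
set, a CPTP decoder, such that every pure state of the message and a reference system of the same
dimension is recovered perfectly from the nodes of the decoding set. -/
def StorageGraph.Fits {N : ℕ} (G : StorageGraph N) (q κ m : ℕ) : Prop :=
  ∃ d : Fin N → ℕ,
    (∀ n, 0 < d n ∧ Real.logb q (d n) ≤ κ * G.size n) ∧
    ∃ enc : Matrix (Fin m) (Fin m) ℂ →ₗ[ℂ]
        Matrix ((i : Fin N) → Fin (d i)) ((i : Fin N) → Fin (d i)) ℂ,
      IsCPTP enc ∧
      ∀ e ∈ G.edges,
        ∃ dec : Matrix (SubIndex d (· ∈ e)) (SubIndex d (· ∈ e)) ℂ →ₗ[ℂ]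
            Matrix (Fin m) (Fin m) ℂ,
          IsCPTP dec ∧
          ∀ φ : Fin m × Fin m → ℂ, ∑ x, ‖φ x‖ ^ 2 = 1 →
            idTensor (Fin m) (dec ∘ₗ eraseOutside d e ∘ₗ enc) (pureState φ) = pureState φ

/-- The storage capacity: the supremum, over all qudit dimensions `q ≥ 2` and all scaling factors
`κ ≥ 1`, of the `l₀` such that `(G, q, κ)` fits a message of size `κ * l₀` qudits. It is taken in
the extended reals, where every supremum exists. -/
noncomputable def StorageGraph.capacity {N : ℕ} (G : StorageGraph N) : EReal :=
  ⨆ (q : ℕ) (_ : 2 ≤ q) (κ : ℕ) (_ : 1 ≤ κ),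
    sSup {x : EReal | ∃ l₀ : ℝ, x = l₀ ∧
      ∃ m : ℕ, 0 < m ∧ Real.logb q m = κ * l₀ ∧ G.Fits q κ m}

/-- The total relative size of a set of nodes. -/
def StorageGraph.totalSize {N : ℕ} (G : StorageGraph N) (S : Finset (Fin N)) : ℝ :=
  ∑ i ∈ S, G.size i

/-- The MDS graph: the decoding sets are the sets of exactly `K` of the `N` nodes. -/
def mdsGraph {N : ℕ} (lam : Fin N → ℝ) (K : ℕ) : StorageGraph N where
  size := lam
  edges := {e | e.card = K}

/-! Converse: two `K`-sets can be chosen to cover all nodes and to meet in the first `2K-N` nodes.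
Perfect decoding from a set leaves the complementary nodes, even jointly with the environment of the
encoder, decoupled from the reference. Write the Kraus operators of the encoder as a tensor with
indices `J` (environment), `α` (outside `e₁`), `β` (outside `e₂`), `ι` (intersection), `R`
(reference). Rank, the exponential of the Hartley entropy, multiplies across decoupled systems and
grows by a factor of at most `|ι|` when `ι` is adjoined, so `|R| rk(Jα) ≤ rk(RJα) = rk(ιβ) ≤ |ι|
rk(β)`, and symmetrically `|R| rk(β) ≤ |ι| rk(Jα)`. Together these give `|R| ≤ |ι|`
(`card_le_of_decoupled`, `StorageGraph.Fits.le_prod`).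

Achievability: cap every size at the `(2K-N)`-th smallest one and use a quantum Reed–Solomon code
over a large prime field. The message fills the high coefficients of a polynomial and a uniform
superposition fills the low ones. Any `K` nodes determine the polynomial, and the noise completely
masks the message on the other `N-K` nodes (`StorageGraph.fits_of_words`,
`StorageGraph.fits_reedSolomon`). Rounding to whole symbols costs at most `N/κ`, which vanishes in
the supremum. -/

open Matrix

/-! ### Kraus representations and the identity channel. -/

/-- The map `X ↦ ∑ k, D k * X * (D k)ᴴ` with Kraus operators `D`. -/
noncomputable def krausMap {κ m n : Type} [Fintype κ] [Fintype m] (D : κ → Matrix n m ℂ) :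
    Matrix m m ℂ →ₗ[ℂ] Matrix n n ℂ where
  toFun X := ∑ k, D k * X * (D k)ᴴ
  map_add' X Y := by simp [Matrix.mul_add, Matrix.add_mul, Finset.sum_add_distrib]
  map_smul' c X := by simp [Finset.smul_sum]

section Kraus

variable {κ κ' m n l : Type} [Fintype κ] [Fintype κ'] [Fintype m]

theorem krausMap_apply (D : κ → Matrix n m ℂ) (X : Matrix m m ℂ) :
    krausMap D X = ∑ k, D k * X * (D k)ᴴ := rfl

theorem krausMap_comp [Fintype n] (D : κ → Matrix l n ℂ) (M : κ' → Matrix n m ℂ) :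
    krausMap D ∘ₗ krausMap M = krausMap fun p : κ × κ' => D p.1 * M p.2 := by
  ext1 X
  simp only [LinearMap.comp_apply, krausMap_apply, Fintype.sum_prod_type, Matrix.mul_sum,
    Matrix.sum_mul, Matrix.conjTranspose_mul, Matrix.mul_assoc]

theorem krausMap_single [DecidableEq m] (D : κ → Matrix n m ℂ) (a b : m) (x y : n) :
    krausMap D (single a b 1) x y = ∑ k, D k x a * star (D k y b) := by
  simp only [krausMap_apply, Matrix.sum_apply]
  refine Finset.sum_congr rfl fun k _ => ?_
  rw [Matrix.mul_apply]
  rw [Finset.sum_eq_single b]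
  · simp
  · intro c _ hc
    simp [Matrix.mul_single_apply_of_ne _ _ _ _ _ hc]
  · simp

theorem trace_krausMap [Fintype n] [DecidableEq m] (D : κ → Matrix n m ℂ) (X : Matrix m m ℂ) :
    (krausMap D X).trace = ((∑ k, (D k)ᴴ * D k) * X).trace := by
  simp only [krausMap_apply, Matrix.trace_sum, Matrix.sum_mul]
  refine Finset.sum_congr rfl fun k _ => ?_
  rw [Matrix.trace_mul_comm, Matrix.mul_assoc]

/-- A map with a Kraus decomposition of the identity is completely positive and trace
preserving. -/
theorem isCPTP_krausMap [Fintype n] [DecidableEq m] (D : κ → Matrix n m ℂ) (hD : ∑ k, (D k)ᴴ * D k = 1) :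
    IsCPTP (krausMap D) := by
  refine ⟨fun k X hX => ?_, fun X => by rw [trace_krausMap, hD, one_mul]⟩
  let E : κ → Matrix (Fin k × n) (Fin k × m) ℂ := fun j =>
    Matrix.of fun x y => if x.1 = y.1 then D j x.2 y.2 else 0
  have key : idTensor (Fin k) (krausMap D) X = ∑ j, E j * X * (E j)ᴴ := by
    ext ⟨r, x⟩ ⟨s, y⟩
    simp only [idTensor, krausMap_apply, Matrix.of_apply, Matrix.sum_apply, Matrix.mul_apply,
      Matrix.conjTranspose_apply, E, Fintype.sum_prod_type]
    refine Finset.sum_congr rfl fun j _ => ?_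
    simp [ite_mul, apply_ite]
  rw [key]
  exact Matrix.posSemidef_sum _ fun j _ => hX.mul_mul_conjTranspose_same (E j)

/-- Every completely positive trace preserving map has a Kraus decomposition. -/
theorem IsCPTP.exists_krausMap [Fintype n] [DecidableEq m] {Φ : Matrix m m ℂ →ₗ[ℂ] Matrix n n ℂ}
    (hΦ : IsCPTP Φ) :
    ∃ (k : ℕ) (D : Fin k → Matrix n m ℂ), Φ = krausMap D ∧ ∑ j, (D j)ᴴ * D j = 1 := by
  classical
  let f := Fintype.equivFin m
  -- `v` is the unnormalised maximally entangled vector, so `hC` says that the Choi matrix is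
  -- positive; its rank one summands, reshaped, are the Kraus operators.
  let v : Fin (Fintype.card m) × m → ℂ := fun x => if f.symm x.1 = x.2 then 1 else 0
  have hC := hΦ.1 (Fintype.card m) (vecMulVec v (star v)) (posSemidef_vecMulVec_self_star v)
  obtain ⟨k, u, hB⟩ := Matrix.posSemidef_iff_eq_sum_vecMulVec.mp hC
  let D : Fin k → Matrix n m ℂ := fun j => Matrix.of fun x a => u j (f a, x)
  have hblock : ∀ a b, (Matrix.of fun a' b' => vecMulVec v (star v) (f a, a') (f b, b')) =
      single a b (1 : ℂ) := by
    intro a b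
    ext a' b'
    simp [v, vecMulVec_apply, Matrix.single_apply, ← ite_and, and_comm]
  have h1 : Φ = krausMap D := by
    refine Matrix.ext_linearMap _ fun a b => LinearMap.ext_ring ?_
    ext x y
    have := congrFun (congrFun hB (f a, x)) (f b, y)
    simp only [idTensor, Matrix.of_apply] at this
    rw [hblock] at this
    refine this.trans (Eq.trans ?_ (krausMap_single D a b x y).symm)
    simp [D, Matrix.sum_apply, vecMulVec_apply]
  refine ⟨_, D, h1, ?_⟩
  ext a b
  have h2 := hΦ.2 (single b a 1)
  rw [h1, trace_krausMap] at h2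
  rw [Matrix.trace_mul_single] at h2
  by_cases hab : a = b
  · subst hab
    simpa using h2
  · simpa [hab, Matrix.trace_single_eq_of_ne _ _ _ (Ne.symm hab)] using h2

/-- The Kraus operators of the identity channel are scalar. -/
theorem exists_smul_one_of_krausMap_eq_id [DecidableEq m] (M : κ → Matrix m m ℂ)
    (h : krausMap M = LinearMap.id) (k : κ) : ∃ c : ℂ, M k = c • (1 : Matrix m m ℂ) := by
  have key : ∀ a b x y, ∑ k, M k x a * star (M k y b) = single a b (1 : ℂ) x y := fun a b x y => by
    rw [← krausMap_single, h]; rfl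
  have hz : ∀ f : κ → ℂ, ∑ k, f k * star (f k) = 0 → ∀ k, f k = 0 := by
    intro f hf k
    have h0 := (Finset.sum_eq_zero_iff_of_nonneg fun k _ => mul_star_self_nonneg (f k)).mp hf k
      (Finset.mem_univ k)
    simpa using h0
  have hoff : ∀ x a, x ≠ a → M k x a = 0 := fun x a hxa =>
    hz (fun k => M k x a) ((key a a x x).trans (by simp [hxa.symm])) k
  -- For `x ≠ a` the sum over `k` of `|M k x x - M k a a|²` expands to `1 - 1 - 1 + 1 = 0`.
  have hdiag : ∀ x a, M k x x = M k a a := fun x a => by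
    by_cases hxa : x = a
    · rw [hxa]
    refine sub_eq_zero.mp (hz (fun k => M k x x - M k a a) ?_ k)
    simp only [star_sub, sub_mul, mul_sub, Finset.sum_sub_distrib, key]
    simp
  rcases isEmpty_or_nonempty m with hm | ⟨⟨a⟩⟩
  · exact ⟨0, Subsingleton.elim _ _⟩
  refine ⟨M k a a, ?_⟩
  ext x y
  by_cases hxy : x = y
  · subst hxy; simp [hdiag x a]
  · simp [hxy, hoff x y hxy]

end Kraus

theorem idTensor_id (R : Type) {m : Type} (X : Matrix (R × m) (R × m) ℂ) :
    idTensor R (LinearMap.id : Matrix m m ℂ →ₗ[ℂ] Matrix m m ℂ) X = X := rfl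

/-- A channel which preserves the maximally entangled state is the identity. -/
theorem eq_id_of_idTensor_pureState {m : ℕ} (Φ : Matrix (Fin m) (Fin m) ℂ →ₗ[ℂ] Matrix (Fin m) (Fin m) ℂ)
    (h : ∀ φ : Fin m × Fin m → ℂ, ∑ x, ‖φ x‖ ^ 2 = 1 →
      idTensor (Fin m) Φ (pureState φ) = pureState φ) : Φ = LinearMap.id := by
  rcases Nat.eq_zero_or_pos m with rfl | hm
  · exact LinearMap.ext fun X => Subsingleton.elim _ _
  have hm' : (m : ℝ) ≠ 0 := by positivity
  let s : ℝ := (Real.sqrt m)⁻¹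
  have hs : s * s = (m : ℝ)⁻¹ := by
    rw [← mul_inv, Real.mul_self_sqrt (Nat.cast_nonneg m)]
  have hs0 : (s : ℂ) * s ≠ 0 := by
    rw [← Complex.ofReal_mul, hs]; simpa using hm.ne'
  let φ : Fin m × Fin m → ℂ := fun x => if x.1 = x.2 then (s : ℂ) else 0
  have hφ : ∑ x, ‖φ x‖ ^ 2 = 1 := by
    simp [φ, Fintype.sum_prod_type, apply_ite, pow_two, hs, hm']
  have h1 := h φ hφ
  have hb : ∀ a b, (Matrix.of fun a' b' => pureState φ (a, a') (b, b')) =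
      ((s : ℂ) * s) • single a b (1 : ℂ) := by
    intro a b
    ext a' b'
    by_cases h1 : a = a' <;> by_cases h2 : b = b' <;>
      simp [pureState, φ, vecMulVec_apply, h1, h2]
  refine Matrix.ext_linearMap _ fun a b => LinearMap.ext_ring ?_
  have h2 : Φ (((s : ℂ) * s) • single a b (1 : ℂ)) = ((s : ℂ) * s) • single a b (1 : ℂ) := by
    rw [← hb]
    ext x y
    exact congrFun (congrFun h1 (a, x)) (b, y)
  rw [map_smul] at h2
  exact smul_right_injective _ hs0 h2

/-- Kraus operators of a channel followed by the erasure of the nodes outside `e`. -/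
theorem eraseOutside_comp_krausMap {N m : ℕ} {κ : Type} [Fintype κ] (d : Fin N → ℕ)
    (e : Finset (Fin N)) (M : κ → Matrix ((i : Fin N) → Fin (d i)) (Fin m) ℂ) :
    eraseOutside d e ∘ₗ krausMap M =
      krausMap fun p : SubIndex d (fun i => ¬ i ∈ e) × κ => (M p.2).submatrix
        (fun x => (Equiv.piEquivPiSubtypeProd (· ∈ e) fun i => Fin (d i)).symm (x, p.1)) id := by
  ext1 X
  ext x y
  simp [eraseOutside, krausMap_apply, Matrix.sum_apply, Fintype.sum_prod_type, Matrix.mul_apply]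

theorem trace_eraseOutside {N : ℕ} (d : Fin N → ℕ) (e : Finset (Fin N))
    (X : Matrix ((i : Fin N) → Fin (d i)) ((i : Fin N) → Fin (d i)) ℂ) :
    (eraseOutside d e X).trace = X.trace := by
  simp only [Matrix.trace, eraseOutside, LinearMap.coe_mk, AddHom.coe_mk, Matrix.diag_apply,
    Matrix.of_apply]
  rw [← Fintype.sum_prod_type' (f := fun x z =>
    X ((Equiv.piEquivPiSubtypeProd (· ∈ e) fun i => Fin (d i)).symm (x, z))
      ((Equiv.piEquivPiSubtypeProd (· ∈ e) fun i => Fin (d i)).symm (x, z)))]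
  exact Equiv.sum_comp (Equiv.piEquivPiSubtypeProd (· ∈ e) fun i => Fin (d i)).symm
    fun w => X w w

/-! ### Rank inequalities for tensors: the converse in Hartley entropies. -/

section Rank

variable {p p' z R : Type} [Fintype z]

theorem Matrix.rank_add_finrank_ker (A : Matrix p z ℂ) :
    A.rank + Module.finrank ℂ (LinearMap.ker A.mulVecLin) = Fintype.card z := by
  rw [Matrix.rank, LinearMap.finrank_range_add_finrank_ker, Module.finrank_pi]

/-- Restriction of a vector on `R × z` to its blocks. -/
noncomputable def blockMap (A : Matrix p z ℂ) : (R × z → ℂ) →ₗ[ℂ] (R → p → ℂ) :=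
  LinearMap.pi fun r => A.mulVecLin ∘ₗ LinearMap.funLeft ℂ ℂ (Prod.mk r)

theorem finrank_ker_blockMap [Fintype R] (A : Matrix p z ℂ) :
    Module.finrank ℂ (LinearMap.ker (blockMap (R := R) A)) =
      Fintype.card R * Module.finrank ℂ (LinearMap.ker A.mulVecLin) := by
  have e : LinearMap.ker (blockMap (R := R) A) ≃ₗ[ℂ] (R → LinearMap.ker A.mulVecLin) :=
    { toFun := fun γ r => ⟨fun c => γ.1 (r, c), congrFun γ.2 r⟩
      map_add' := fun _ _ => rfl
      map_smul' := fun _ _ => rfl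
      invFun := fun g => ⟨fun x => (g x.1).1 x.2, funext fun r => (g r).2⟩
      left_inv := fun _ => rfl
      right_inv := fun _ => rfl }
  rw [e.finrank_eq, Module.finrank_pi_fintype]
  simp

/-- The hypothesis puts `ker B` inside the sum of `|R|` copies of `ker A`; rank–nullity turns this
around. It serves as superadditivity of rank under decoupling. -/
theorem Matrix.card_mul_rank_le [Fintype R] (A : Matrix p z ℂ) (B : Matrix p' (R × z) ℂ)
    (h : ∀ γ : R × z → ℂ, B *ᵥ γ = 0 → ∀ r, (A *ᵥ fun c => γ (r, c)) = 0) :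
    Fintype.card R * A.rank ≤ B.rank := by
  have h1 : LinearMap.ker B.mulVecLin ≤ LinearMap.ker (blockMap (R := R) A) :=
    fun γ hγ => funext fun r => h γ hγ r
  have h2 := Submodule.finrank_mono h1
  rw [finrank_ker_blockMap] at h2
  have h3 := A.rank_add_finrank_ker
  have h4 := B.rank_add_finrank_ker
  rw [Fintype.card_prod, ← h3, mul_add] at h4
  omega

/-- The reverse inclusion of kernels. It serves as the bound on the growth of rank when a system of
dimension `|R|` is adjoined. -/
theorem Matrix.rank_le_card_mul [Fintype R] (A : Matrix p z ℂ) (B : Matrix p' (R × z) ℂ)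
    (h : ∀ γ : R × z → ℂ, (∀ r, (A *ᵥ fun c => γ (r, c)) = 0) → B *ᵥ γ = 0) :
    B.rank ≤ Fintype.card R * A.rank := by
  have h1 : LinearMap.ker (blockMap (R := R) A) ≤ LinearMap.ker B.mulVecLin :=
    fun γ hγ => h γ fun r => congrFun hγ r
  have h2 := Submodule.finrank_mono h1
  rw [finrank_ker_blockMap] at h2
  have h3 := A.rank_add_finrank_ker
  have h4 := B.rank_add_finrank_ker
  rw [Fintype.card_prod, ← h3, mul_add] at h4
  omega

theorem Matrix.eq_zero_of_rank_eq_zero {A : Matrix p z ℂ} [Finite p] (h : A.rank = 0) :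
    A = 0 := by
  classical
  rw [Matrix.rank, Submodule.finrank_eq_zero, LinearMap.range_eq_bot] at h
  exact Matrix.ext_of_mulVec_single fun i =>
    (LinearMap.congr_fun h (Pi.single i 1)).trans (Matrix.zero_mulVec _).symm

end Rank

/-- A nonzero tensor `T`, which can be decoupled from its last index both on the side `J, α` and on
the side `β`, has a last index of at most the dimension of `ι`. -/
theorem card_le_of_decoupled {J α β ι R : Type} [Fintype J] [Fintype α] [Fintype β] [Fintype ι]
    [Fintype R] (T : J → α → β → ι → R → ℂ) (hT : ∃ j a b i r, T j a b i r ≠ 0)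
    (h₁ : ∀ γ : R × J × α → ℂ, (∀ b i, ∑ x, T x.2.1 x.2.2 b i x.1 * γ x = 0) →
      ∀ s b i r, ∑ x : J × α, T x.1 x.2 b i r * γ (s, x) = 0)
    (h₂ : ∀ γ : R × β → ℂ, (∀ j a i, ∑ x, T j a x.2 i x.1 * γ x = 0) →
      ∀ s j a i r, ∑ b, T j a b i r * γ (s, b) = 0) :
    Fintype.card R ≤ Fintype.card ι := by
  classical
  -- Flattenings of `T` along the cuts `Jα | βιR`, `β | JαιR`, `RJα | ιβ` and `Rβ | ιJα`.
  -- Transposing `L₁` and `L₂` reads the last two cuts from the other side.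
  let N₁ : Matrix (β × ι × R) (J × α) ℂ := .of fun y x => T x.1 x.2 y.1 y.2.1 y.2.2
  let N₂ : Matrix (J × α × ι × R) β ℂ := .of fun y b => T y.1 y.2.1 b y.2.2.1 y.2.2.2
  let L₁ : Matrix (ι × β) (R × J × α) ℂ := .of fun y x => T x.2.1 x.2.2 y.2 y.1 x.1
  let L₂ : Matrix (ι × J × α) (R × β) ℂ := .of fun y x => T y.2.1 y.2.2 x.2 y.1 x.1
  have a₁ : Fintype.card R * N₁.rank ≤ L₁.rank := Matrix.card_mul_rank_le _ _ fun γ hγ s =>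
    funext fun y => h₁ γ (fun b i => congrFun hγ (i, b)) s y.1 y.2.1 y.2.2
  have a₂ : Fintype.card R * N₂.rank ≤ L₂.rank := Matrix.card_mul_rank_le _ _ fun γ hγ s =>
    funext fun y => h₂ γ (fun j a i => congrFun hγ (i, j, a)) s y.1 y.2.1 y.2.2.1 y.2.2.2
  have b₁ : L₁ᵀ.rank ≤ Fintype.card ι * N₂.rank := by
    refine Matrix.rank_le_card_mul _ _ fun γ hγ => funext fun x => ?_
    refine (Fintype.sum_prod_type _).trans (Finset.sum_eq_zero fun i _ => ?_)
    exact congrFun (hγ i) (x.2.1, x.2.2, i, x.1)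
  have b₂ : L₂ᵀ.rank ≤ Fintype.card ι * N₁.rank := by
    refine Matrix.rank_le_card_mul _ _ fun γ hγ => funext fun x => ?_
    refine (Fintype.sum_prod_type _).trans (Finset.sum_eq_zero fun i _ => ?_)
    exact congrFun (hγ i) (x.2, i, x.1)
  rw [Matrix.rank_transpose] at b₁ b₂
  have hN : 0 < N₁.rank := by
    rw [Nat.pos_iff_ne_zero]
    intro hr
    have h0 := Matrix.eq_zero_of_rank_eq_zero hr
    obtain ⟨j, a, b, i, r, h⟩ := hT
    exact h (congrFun (congrFun h0 (b, i, r)) (j, a))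
  by_contra! hlt
  have c₁ := a₁.trans b₁
  have c₂ := a₂.trans b₂
  rcases le_total N₁.rank N₂.rank with h | h
  · have := Nat.mul_lt_mul_of_pos_right hlt (hN.trans_le h)
    have := Nat.mul_le_mul_left (Fintype.card ι) h
    omega
  · have := Nat.mul_lt_mul_of_pos_right hlt hN
    have := Nat.mul_le_mul_left (Fintype.card ι) h
    omega

/-- If the operators `K t z` admit decoders with scalar products `D k * K t z`, then the index `z`
carries no information on the input. -/
theorem decoupled_of_decoder {κ p t z : Type} {m : ℕ} [Fintype κ] [Fintype p] [DecidableEq p]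
    [Fintype t] [Fintype z]
    (D : κ → Matrix (Fin m) p ℂ) (hD : ∑ k, (D k)ᴴ * D k = 1) (K : t → z → Matrix p (Fin m) ℂ)
    (hK : ∀ k j x, ∃ c : ℂ, D k * K j x = c • (1 : Matrix (Fin m) (Fin m) ℂ))
    (γ : Fin m × z → ℂ) (hγ : ∀ j y, ∑ x, K j x.2 y x.1 * γ x = 0) (s : Fin m) (j : t) (y : p)
    (r : Fin m) : ∑ x, K j x y r * γ (s, x) = 0 := by
  choose c hc using hK
  -- Row `s` of the decoder is applied to the vanishing combination: since `D k * K j x` is scalar,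
  -- only the block `s` of `γ` survives.
  have h1 : ∀ k s, ∑ x, γ (s, x) * c k j x = 0 := by
    intro k s
    have h2 : ∑ y, D k s y * ∑ x, K j x.2 y x.1 * γ x = 0 := by simp [hγ j]
    simp only [Finset.mul_sum] at h2
    rw [Finset.sum_comm] at h2
    have h3 : ∀ x : Fin m × z, ∑ y, D k s y * (K j x.2 y x.1 * γ x) =
        (if s = x.1 then c k j x.2 else 0) * γ x := by
      intro x
      have := congrFun (congrFun (hc k j x.2) s) x.1
      simp only [Matrix.mul_apply, Matrix.smul_apply, Matrix.one_apply, smul_eq_mul, mul_ite,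
        mul_one, mul_zero] at this
      rw [← this, Finset.sum_mul]
      exact Finset.sum_congr rfl fun _ _ => (mul_assoc _ _ _).symm
    simp only [h3, Fintype.sum_prod_type, ite_mul, zero_mul] at h2
    rw [Finset.sum_comm] at h2
    simpa [mul_comm] using h2
  -- Every `D k` annihilates `A`, and `∑ (D k)ᴴ * D k = 1`, so `A = 0`.
  let A : Matrix p (Fin m) ℂ := ∑ x, γ (s, x) • K j x
  have hA : A = 0 := by
    have h2 : ∀ k, D k * A = 0 := by
      intro k
      simp only [A, Matrix.mul_sum, Matrix.mul_smul, hc, smul_smul]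
      rw [← Finset.sum_smul, h1, zero_smul]
    rw [← Matrix.one_mul A, ← hD, Matrix.sum_mul]
    exact Finset.sum_eq_zero fun k _ => by rw [Matrix.mul_assoc, h2, Matrix.mul_zero]
  have := congrFun (congrFun hA y) r
  simpa [A, Matrix.sum_apply, mul_comm] using this

/-- Two decoding sets which cover all nodes: the message dimension is bounded by the dimension of
their intersection. -/
theorem StorageGraph.Fits.le_prod {N : ℕ} {G : StorageGraph N} {q κ m : ℕ} (hm : 0 < m)
    (h : G.Fits q κ m) : ∃ d : Fin N → ℕ,
      (∀ n, 0 < d n ∧ Real.logb q (d n) ≤ κ * G.size n) ∧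
      ∀ e₁ ∈ G.edges, ∀ e₂ ∈ G.edges, e₁ ∪ e₂ = Finset.univ → m ≤ ∏ i ∈ e₁ ∩ e₂, d i := by
  obtain ⟨d, hd, enc, henc, hdec⟩ := h
  refine ⟨d, hd, fun e₁ he₁ e₂ he₂ hcov => ?_⟩
  obtain ⟨l, M, rfl, hM⟩ := henc.exists_krausMap
  have key : ∀ e ∈ G.edges, ∃ (k : ℕ) (D : Fin k → Matrix (Fin m) (SubIndex d (· ∈ e)) ℂ),
      ∑ k, (D k)ᴴ * D k = 1 ∧ ∀ k j z, ∃ c : ℂ, D k * ((M j).submatrix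
        (fun x => (Equiv.piEquivPiSubtypeProd (· ∈ e) fun i => Fin (d i)).symm (x, z)) id) =
          c • (1 : Matrix (Fin m) (Fin m) ℂ) := by
    intro e he
    obtain ⟨dec, hdec, hrec⟩ := hdec e he
    obtain ⟨k, D, rfl, hD⟩ := hdec.exists_krausMap
    refine ⟨k, D, hD, fun k j z => ?_⟩
    have h1 := eq_id_of_idTensor_pureState _ hrec
    rw [eraseOutside_comp_krausMap, krausMap_comp] at h1
    exact exists_smul_one_of_krausMap_eq_id _ h1 (k, z, j)
  obtain ⟨k₁, D₁, hD₁, hs₁⟩ := key e₁ he₁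
  obtain ⟨k₂, D₂, hD₂, hs₂⟩ := key e₂ he₂
  let glue : SubIndex d (fun i => ¬ i ∈ e₁) → SubIndex d (fun i => ¬ i ∈ e₂) →
      SubIndex d (· ∈ e₁ ∩ e₂) → (i : Fin N) → Fin (d i) := fun a b c i =>
    if h₁ : i ∈ e₁ then
      if h₂ : i ∈ e₂ then c ⟨i, Finset.mem_inter.2 ⟨h₁, h₂⟩⟩ else b ⟨i, h₂⟩
    else a ⟨i, h₁⟩
  have hcov' : ∀ i, ¬ i ∈ e₁ → i ∈ e₂ := fun i hi => by
    have : i ∈ e₁ ∪ e₂ := hcov ▸ Finset.mem_univ i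
    exact (Finset.mem_union.1 this).resolve_left hi
  let T : Fin l → SubIndex d (fun i => ¬ i ∈ e₁) → SubIndex d (fun i => ¬ i ∈ e₂) →
      SubIndex d (· ∈ e₁ ∩ e₂) → Fin m → ℂ := fun j a b c r => M j (glue a b c) r
  have glue₁ : ∀ (x : SubIndex d (· ∈ e₁)), ∃ b c, ∀ z,
      (Equiv.piEquivPiSubtypeProd (· ∈ e₁) fun i => Fin (d i)).symm (x, z) = glue z b c := by
    intro x
    refine ⟨fun i => x ⟨i, by by_contra h; exact i.2 (hcov' i h)⟩,
      fun i => x ⟨i, (Finset.mem_inter.1 i.2).1⟩, fun z => ?_⟩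
    funext i
    by_cases h₁ : i ∈ e₁ <;> by_cases h₂ : i ∈ e₂ <;>
      simp [glue, Equiv.piEquivPiSubtypeProd, h₁, h₂]
  have glue₁' : ∀ b c, ∃ x : SubIndex d (· ∈ e₁), ∀ z,
      (Equiv.piEquivPiSubtypeProd (· ∈ e₁) fun i => Fin (d i)).symm (x, z) = glue z b c := by
    intro b c
    refine ⟨fun i => if h₂ : i.1 ∈ e₂ then c ⟨i, Finset.mem_inter.2 ⟨i.2, h₂⟩⟩ else b ⟨i, h₂⟩,
      fun z => ?_⟩
    funext i
    by_cases h₁ : i ∈ e₁ <;> by_cases h₂ : i ∈ e₂ <;>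
      simp [glue, Equiv.piEquivPiSubtypeProd, h₁, h₂]
  have glue₂ : ∀ (x : SubIndex d (· ∈ e₂)), ∃ a c, ∀ z,
      (Equiv.piEquivPiSubtypeProd (· ∈ e₂) fun i => Fin (d i)).symm (x, z) = glue a z c := by
    intro x
    refine ⟨fun i => x ⟨i, hcov' i i.2⟩,
      fun i => x ⟨i, (Finset.mem_inter.1 i.2).2⟩, fun z => ?_⟩
    funext i
    by_cases h₂ : i ∈ e₂
    · by_cases h₁ : i ∈ e₁ <;> simp [glue, Equiv.piEquivPiSubtypeProd, h₁, h₂]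
    · have h₁ : i ∈ e₁ := by by_contra h; exact h₂ (hcov' i h)
      simp [glue, Equiv.piEquivPiSubtypeProd, h₁, h₂]
  have glue₂' : ∀ a c, ∃ x : SubIndex d (· ∈ e₂), ∀ z,
      (Equiv.piEquivPiSubtypeProd (· ∈ e₂) fun i => Fin (d i)).symm (x, z) = glue a z c := by
    intro a c
    refine ⟨fun i => if h₁ : i.1 ∈ e₁ then c ⟨i, Finset.mem_inter.2 ⟨h₁, i.2⟩⟩ else a ⟨i, h₁⟩,
      fun z => ?_⟩
    funext i
    by_cases h₂ : i ∈ e₂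
    · by_cases h₁ : i ∈ e₁ <;> simp [glue, Equiv.piEquivPiSubtypeProd, h₁, h₂]
    · have h₁ : i ∈ e₁ := by by_contra h; exact h₂ (hcov' i h)
      simp [glue, Equiv.piEquivPiSubtypeProd, h₁, h₂]
  have hT : ∃ j a b c r, T j a b c r ≠ 0 := by
    by_contra! h0
    have hM0 : ∀ j, M j = 0 := by
      intro j
      ext x r
      let x₁ := Equiv.piEquivPiSubtypeProd (· ∈ e₁) (fun i => Fin (d i)) x
      obtain ⟨b, c, hx⟩ := glue₁ x₁.1
      have h1 := h0 j x₁.2 b c r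
      simp only [T, ← hx] at h1
      rwa [show (x₁.1, x₁.2) = x₁ from rfl, Equiv.symm_apply_apply] at h1
    have h1 := congrFun (congrFun hM ⟨0, hm⟩) ⟨0, hm⟩
    simp [hM0] at h1
  have := card_le_of_decoupled T hT ?_ ?_
  · simp only [Fintype.card_fin, Fintype.card_pi] at this
    exact this.trans_eq (Finset.prod_coe_sort (e₁ ∩ e₂) d)
  · intro γ hγ s b c r
    obtain ⟨y, hy⟩ := glue₁' b c
    -- The environment label is counted with the nodes lost by `e₁`; for `e₂` below it is a
    -- parameter instead, so that it lies on the side `Jα` both times.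
    have := decoupled_of_decoder D₁ hD₁ (fun (_ : Unit) (z : Fin l × SubIndex d (fun i => ¬ i ∈ e₁)) =>
      (M z.1).submatrix (fun x =>
        (Equiv.piEquivPiSubtypeProd (· ∈ e₁) fun i => Fin (d i)).symm (x, z.2)) id)
      (fun k _ z => hs₁ k z.1 z.2) γ ?_ s () y r
    · simpa only [Matrix.submatrix_apply, hy, id_eq] using this
    · intro _ x
      obtain ⟨b, c, hx⟩ := glue₁ x
      simpa only [Matrix.submatrix_apply, hx, id_eq] using hγ b c
  · intro γ hγ s j a c r
    obtain ⟨y, hy⟩ := glue₂' a c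
    have := decoupled_of_decoder D₂ hD₂ (fun j (z : SubIndex d (fun i => ¬ i ∈ e₂)) =>
      (M j).submatrix (fun x =>
        (Equiv.piEquivPiSubtypeProd (· ∈ e₂) fun i => Fin (d i)).symm (x, z)) id)
      (fun k j z => hs₂ k j z) γ ?_ s j y r
    · simpa only [Matrix.submatrix_apply, hy, id_eq] using this
    · intro j x
      obtain ⟨a, c, hx⟩ := glue₂ x
      simpa only [Matrix.submatrix_apply, hx, id_eq] using hγ j a c

/-! ### Codes from classical words, and Reed–Solomon codes. -/

/-- An injection of the labels of a system into a product gives a channel to the first factor. -/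
theorem sum_conjTranspose_mul_self_of_injective {X U J : Type} [Fintype X] [DecidableEq X]
    [Fintype U] [DecidableEq U] [Fintype J] [DecidableEq J] (f : X → U × J)
    (hf : Function.Injective f) :
    ∑ j, ((Matrix.of fun u x => if f x = (u, j) then (1 : ℂ) else 0 : Matrix U X ℂ)ᴴ *
      (Matrix.of fun u x => if f x = (u, j) then (1 : ℂ) else 0 : Matrix U X ℂ)) = 1 := by
  ext x y
  simp only [Matrix.sum_apply, Matrix.mul_apply, Matrix.conjTranspose_apply, Matrix.of_apply]
  rw [Finset.sum_comm, ← Fintype.sum_prod_type' (f := fun u j =>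
    star (if f x = (u, j) then (1 : ℂ) else 0) * if f y = (u, j) then (1 : ℂ) else 0)]
  rw [Finset.sum_eq_single (f x)]
  · by_cases hxy : x = y
    · subst hxy
      simp
    · have : f y ≠ f x := fun h => hxy (hf h).symm
      simp [hxy, this]
  · intro b _ hb
    simp [hb.symm]
  · simp

/-- The isometry which encodes `u` into the uniform superposition of the words `g u v`. -/
theorem isometry_of_injective {X U V : Type} [Fintype X] [DecidableEq X] [DecidableEq U]
    [Fintype V] [Nonempty V] (g : U → V → X) (hg : ∀ u v u' v', g u v = g u' v' → u = u' ∧ v = v') :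
    (Matrix.of fun x u => (((Real.sqrt (Fintype.card V))⁻¹ : ℝ) : ℂ) *
        ∑ v, if g u v = x then 1 else 0 : Matrix X U ℂ)ᴴ *
      (Matrix.of fun x u => (((Real.sqrt (Fintype.card V))⁻¹ : ℝ) : ℂ) *
        ∑ v, if g u v = x then 1 else 0 : Matrix X U ℂ) = 1 := by
  classical
  set s : ℝ := (Real.sqrt (Fintype.card V))⁻¹ with hs
  have hs2 : (s : ℂ) * s * Fintype.card V = 1 := by
    have : s * s * Fintype.card V = 1 := by
      rw [hs, ← mul_inv, Real.mul_self_sqrt (Nat.cast_nonneg _)]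
      exact inv_mul_cancel₀ (by simp)
    exact_mod_cast this
  ext u u'
  simp only [Matrix.mul_apply, Matrix.conjTranspose_apply, Matrix.of_apply]
  have h1 : ∀ x, star ((s : ℂ) * ∑ v, if g u v = x then 1 else 0) *
      ((s : ℂ) * ∑ v, if g u' v = x then 1 else 0) =
      (s : ℂ) * s * ∑ v, ∑ v', if g u v = x then (if g u' v' = x then 1 else 0) else 0 := by
    intro x
    simp only [star_mul', star_sum, Complex.star_def, Complex.conj_ofReal, apply_ite (starRingEnd ℂ),
      map_one, map_zero]
    rw [mul_mul_mul_comm, Finset.sum_mul_sum]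
    simp only [ite_mul, one_mul, zero_mul]
  simp only [h1]
  rw [← Finset.mul_sum, Finset.sum_comm]
  have h2 : ∀ v, (∑ x, ∑ v', if g u v = x then (if g u' v' = x then (1 : ℂ) else 0) else 0) =
      if u = u' then 1 else 0 := by
    intro v
    rw [Finset.sum_comm]
    simp only [Finset.sum_ite_eq, Finset.mem_univ, if_true]
    by_cases huu : u = u'
    · subst huu
      rw [Finset.sum_eq_single v]
      · simp
      · intro v' _ hv
        rw [if_neg fun h => hv (hg _ _ _ _ h).2]
      · simp
    · rw [if_neg huu]
      exact Finset.sum_eq_zero fun v' _ => if_neg fun h => huu (hg _ _ _ _ h).1.symm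
  simp only [h2, Finset.sum_const, Finset.card_univ, nsmul_eq_mul, Matrix.one_apply]
  rw [← mul_assoc, hs2, one_mul]

/-- Codes given by words `g u v`, with the message `u` and uniform noise `v`: the nodes in a decoding
set determine the word, and the distribution on the other nodes does not depend on the message. -/
theorem StorageGraph.fits_of_words {N : ℕ} {G : StorageGraph N} {q κ m : ℕ} (hm : 0 < m)
    (d : Fin N → ℕ) (hd : ∀ n, 0 < d n ∧ Real.logb q (d n) ≤ κ * G.size n)
    {V : Type} [Fintype V] [Nonempty V] (g : Fin m → V → (i : Fin N) → Fin (d i))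
    (hg : ∀ u v u' v', g u v = g u' v' → u = u' ∧ v = v')
    (hdec : ∀ e ∈ G.edges, ∀ u v u' v', (∀ i ∈ e, g u v i = g u' v' i) → u = u' ∧ v = v')
    (hind : ∀ e ∈ G.edges, ∃ σ : Fin m → Equiv.Perm V, ∀ u u' v, ∀ i, i ∉ e →
      g u (σ u v) i = g u' (σ u' v) i) :
    G.Fits q κ m := by
  classical
  set s : ℂ := (((Real.sqrt (Fintype.card V))⁻¹ : ℝ) : ℂ) with hs
  let W : Matrix ((i : Fin N) → Fin (d i)) (Fin m) ℂ :=
    Matrix.of fun x u => s * ∑ v, if g u v = x then 1 else 0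
  have hW : Wᴴ * W = 1 := isometry_of_injective g hg
  have hW' : ∑ _k : Unit, Wᴴ * W = 1 := by simpa using hW
  refine ⟨d, hd, krausMap fun _ : Unit => W, isCPTP_krausMap _ hW', fun e he => ?_⟩
  obtain ⟨σ, hσ⟩ := hind e he
  let u₀ : Fin m := ⟨0, hm⟩
  let P : SubIndex d (· ∈ e) → Fin m × V → Prop := fun x p => ∀ i, g p.1 (σ p.1 p.2) i.1 = x i
  have hP : ∀ x p p', P x p → P x p' → p = p' := by
    rintro x ⟨u, v⟩ ⟨u', v'⟩ h h'
    obtain ⟨rfl, h2⟩ := hdec e he u (σ u v) u' (σ u' v') fun i hi => (h ⟨i, hi⟩).trans (h' ⟨i, hi⟩).symm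
    rw [(σ u).injective h2]
  -- The decoder reads off the message and the noise relabelled by `σ`. Labels that come from no
  -- word go to a separate summand, which keeps `f` injective.
  let f : SubIndex d (· ∈ e) → Fin m × (V ⊕ SubIndex d (· ∈ e)) := fun x =>
    if h : ∃ p, P x p then (h.choose.1, Sum.inl h.choose.2) else (u₀, Sum.inr x)
  have hf : Function.Injective f := by
    intro x y hxy
    by_cases hx : ∃ p, P x p <;> by_cases hy : ∃ p, P y p
    · simp only [f, dif_pos hx, dif_pos hy, Prod.mk.injEq, Sum.inl.injEq] at hxy
      have h1 := hx.choose_spec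
      have h2 := hy.choose_spec
      rw [← Prod.ext hxy.1 hxy.2] at h2
      exact funext fun i => (h1 i).symm.trans (h2 i)
    · simp only [f, dif_pos hx, dif_neg hy, Prod.mk.injEq, reduceCtorEq, and_false] at hxy
    · simp only [f, dif_neg hx, dif_pos hy, Prod.mk.injEq, reduceCtorEq, and_false] at hxy
    · simp only [f, dif_neg hx, dif_neg hy, Prod.mk.injEq, Sum.inr.injEq, true_and] at hxy
      exact hxy
  have hfP : ∀ x p, P x p → f x = (p.1, Sum.inl p.2) := by
    intro x p hp
    have hx : ∃ p, P x p := ⟨p, hp⟩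
    simp only [f, dif_pos hx]
    rw [hP x _ _ hx.choose_spec hp]
  let D : (V ⊕ SubIndex d (· ∈ e)) → Matrix (Fin m) (SubIndex d (· ∈ e)) ℂ := fun j =>
    Matrix.of fun u x => if f x = (u, j) then (1 : ℂ) else 0
  have hD : ∑ j, (D j)ᴴ * D j = 1 := sum_conjTranspose_mul_self_of_injective f hf
  refine ⟨krausMap D, isCPTP_krausMap _ hD, fun φ _ => ?_⟩
  suffices h : krausMap D ∘ₗ eraseOutside d e ∘ₗ krausMap (fun _ : Unit => W) = LinearMap.id by
    rw [h, idTensor_id]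
  have htr : ∀ X, ((krausMap D ∘ₗ eraseOutside d e ∘ₗ krausMap (fun _ : Unit => W)) X).trace =
      X.trace := by
    intro X
    rw [LinearMap.comp_apply, LinearMap.comp_apply, trace_krausMap, hD, one_mul, trace_eraseOutside,
      trace_krausMap, hW', one_mul]
  rw [eraseOutside_comp_krausMap, krausMap_comp] at htr ⊢
  -- After relabelling, the lost symbols depend on `v` alone, so `u₀` stands for any message and the
  -- Kraus operators of the whole process are scalars `c p`.
  let h : V → SubIndex d (fun i => ¬ i ∈ e) := fun v i => g u₀ (σ u₀ v) i.1
  let c : (V ⊕ SubIndex d (· ∈ e)) × SubIndex d (fun i => ¬ i ∈ e) × Unit → ℂ := fun p =>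
    s * ∑ v, if Sum.inl v = p.1 ∧ h v = p.2.1 then 1 else 0
  have hM : ∀ p : (V ⊕ SubIndex d (· ∈ e)) × SubIndex d (fun i => ¬ i ∈ e) × Unit,
      D p.1 * W.submatrix (fun x =>
        (Equiv.piEquivPiSubtypeProd (· ∈ e) fun i => Fin (d i)).symm (x, p.2.1)) id =
      c p • (1 : Matrix (Fin m) (Fin m) ℂ) := by
    rintro ⟨j, z, _⟩
    ext a u
    simp only [Matrix.mul_apply, Matrix.submatrix_apply, Matrix.smul_apply, Matrix.one_apply,
      D, W, Matrix.of_apply, c, id_eq, smul_eq_mul]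
    simp only [mul_left_comm _ s, mul_assoc s, ← Finset.mul_sum]
    congr 1
    simp only [Finset.mul_sum, Finset.sum_mul]
    rw [Finset.sum_comm, ← Equiv.sum_comp (σ u)]
    refine Finset.sum_congr rfl fun v _ => ?_
    have hx : ∀ x, g u (σ u v) = (Equiv.piEquivPiSubtypeProd (· ∈ e) fun i => Fin (d i)).symm (x, z) ↔
        P x (u, v) ∧ h v = z := by
      intro x
      rw [Equiv.eq_symm_apply]
      simp only [Equiv.piEquivPiSubtypeProd, Equiv.coe_fn_mk, Prod.mk.injEq, P, h, funext_iff]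
      refine and_congr Iff.rfl (forall_congr' fun i => ?_)
      rw [hσ u u₀ v i i.2]
    rw [Finset.sum_eq_single (fun i : {i // i ∈ e} => g u (σ u v) i.1)]
    · have h1 : P (fun i : {i // i ∈ e} => g u (σ u v) i.1) (u, v) := fun i => rfl
      simp only [hx, h1, hfP _ _ h1, true_and, Prod.mk.injEq, @eq_comm _ u a]
      by_cases h1 : a = u <;> by_cases h2 : Sum.inl v = j <;> by_cases h3 : h v = z <;>
        simp [h1, h2, h3]
    · intro x _ hxne
      rw [if_neg (c := g u (σ u v) = _) (fun h' => hxne ?_), mul_zero]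
      exact funext fun i => (((hx x).1 h').1 i).symm
    · simp
  have hsc : ∀ X : Matrix (Fin m) (Fin m) ℂ, krausMap (fun p : (V ⊕ SubIndex d (· ∈ e)) ×
      SubIndex d (fun i => ¬ i ∈ e) × Unit => D p.1 * W.submatrix (fun x =>
        (Equiv.piEquivPiSubtypeProd (· ∈ e) fun i => Fin (d i)).symm (x, p.2.1)) id) X =
      (∑ p, c p * star (c p)) • X := by
    intro X
    simp only [krausMap_apply, hM, Finset.sum_smul, Matrix.conjTranspose_smul,
      Matrix.conjTranspose_one, Matrix.smul_mul, Matrix.mul_smul, one_mul, mul_one, smul_smul]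
    simp only [mul_comm]
  -- Trace preservation fixes the scalar without evaluating the sum.
  have hone : ∑ p, c p * star (c p) = 1 := by
    have h1 := htr 1
    rw [hsc, Matrix.trace_smul, Matrix.trace_one, Fintype.card_fin, smul_eq_mul] at h1
    exact mul_right_cancel₀ (Nat.cast_ne_zero.2 hm.ne') (h1.trans (one_mul _).symm)
  exact LinearMap.ext fun X => by rw [hsc, hone, one_smul, LinearMap.id_apply]

open Polynomial in
/-- Reed–Solomon codes with `k i` symbols in node `i`, with messages of `a` symbols and noise of `c`
symbols. -/
theorem StorageGraph.fits_reedSolomon {N : ℕ} {G : StorageGraph N} {p κ : ℕ} [hp : Fact p.Prime]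
    (k : Fin N → ℕ) (a c : ℕ) (hkp : ∑ i, k i ≤ p) (hk : ∀ i, (k i : ℝ) ≤ κ * G.size i)
    (htot : a + c ≤ ∑ i, k i) (hin : ∀ e ∈ G.edges, a + c ≤ ∑ i ∈ e, k i)
    (hout : ∀ e ∈ G.edges, ∑ i ∈ eᶜ, k i ≤ c) : G.Fits p κ (p ^ a) := by
  classical
  obtain ⟨α⟩ : Nonempty ((Σ i, Fin (k i)) ↪ ZMod p) :=
    Function.Embedding.nonempty_of_card_le (by simpa [ZMod.card] using hkp)
  let ε : ∀ i, (Fin (k i) → ZMod p) ≃ Fin (p ^ k i) := fun i =>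
    Fintype.equivFinOfCardEq (by simp [ZMod.card])
  let μ : Fin (p ^ a) ≃ degreeLT (ZMod p) a :=
    ((degreeLTEquiv (ZMod p) a).toEquiv.trans (Fintype.equivFinOfCardEq (by simp [ZMod.card]))).symm
  let ν : (Fin c → ZMod p) ≃ₗ[ZMod p] degreeLT (ZMod p) c := (degreeLTEquiv (ZMod p) c).symm
  let P : Fin (p ^ a) → (Fin c → ZMod p) → (ZMod p)[X] := fun u v => (ν v).1 + X ^ c * (μ u).1
  have hdeg : ∀ u v, (P u v).degree < ((a + c : ℕ) : WithBot ℕ) := by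
    intro u v
    refine (degree_add_le _ _).trans_lt (max_lt ?_ ?_)
    · exact (mem_degreeLT.1 (ν v).2).trans_le (by exact_mod_cast Nat.le_add_left c a)
    · by_cases h0 : (μ u).1 = 0
      · rw [h0, mul_zero, degree_zero]
        exact WithBot.bot_lt_coe _
      · have h1 := mem_degreeLT.1 (μ u).2
        rw [degree_mul, degree_X_pow, degree_eq_natDegree h0]
        rw [degree_eq_natDegree h0] at h1
        have h2 : (μ u).1.natDegree < a := by exact_mod_cast h1
        have h3 : c + (μ u).1.natDegree < a + c := by omega
        exact_mod_cast h3
  have hinj : ∀ u v u' v', P u v = P u' v' → u = u' ∧ v = v' := by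
    intro u v u' v' h
    have hmod : ∀ u v, P u v /ₘ X ^ c = (μ u).1 ∧ P u v %ₘ X ^ c = (ν v).1 := fun u v =>
      div_modByMonic_unique _ _ (monic_X_pow c) ⟨rfl, by
        rw [degree_X_pow]; exact mem_degreeLT.1 (ν v).2⟩
    have h1 := hmod u v
    rw [h] at h1
    have h2 := hmod u' v'
    exact ⟨μ.injective (Subtype.ext (h1.1.symm.trans h2.1)),
      ν.injective (Subtype.ext (h1.2.symm.trans h2.2))⟩
  let g : Fin (p ^ a) → (Fin c → ZMod p) → (i : Fin N) → Fin (p ^ k i) := fun u v i =>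
    ε i fun s => (P u v).eval (α ⟨i, s⟩)
  have hdec : ∀ e : Finset (Fin N), a + c ≤ ∑ i ∈ e, k i → ∀ u v u' v',
      (∀ i ∈ e, g u v i = g u' v' i) → u = u' ∧ v = v' := by
    intro e he u v u' v' h
    have hcard : ((a + c : ℕ) : WithBot ℕ) ≤
        ((e.sigma fun i => (Finset.univ : Finset (Fin (k i)))).card : WithBot ℕ) := by
      rw [Finset.card_sigma]
      simp only [Finset.card_univ, Fintype.card_fin]
      exact_mod_cast he
    refine hinj _ _ _ _ (Polynomial.eq_of_degrees_lt_of_eval_index_eq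
      (e.sigma fun i => (Finset.univ : Finset (Fin (k i)))) (v := α) α.injective.injOn
      ((hdeg u v).trans_le hcard) ((hdeg u' v').trans_le hcard) ?_)
    rintro ⟨i, s⟩ hi
    exact congrFun ((ε i).injective (h i (Finset.mem_sigma.1 hi).1)) s
  refine StorageGraph.fits_of_words (Nat.pow_pos hp.out.pos) (fun i => p ^ k i) (fun i => ?_)
    g (fun u v u' v' h => hdec Finset.univ htot u v u' v' fun i _ => congrFun h i)
    (fun e he => hdec e (hin e he)) fun e he => ?_
  · refine ⟨Nat.pow_pos hp.out.pos, ?_⟩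
    rw [Nat.cast_pow, Real.logb_pow, Real.logb_self_eq_one (by exact_mod_cast hp.out.one_lt),
      mul_one]
    exact hk i
  -- At most `c` points are lost, so some noise polynomial of degree `< c` agrees there with the
  -- message part; shifting the noise by it hides the message.
  · have hex : ∀ u, ∃ t : Fin c → ZMod p, ∀ i, i ∉ e → ∀ s,
        (ν t).1.eval (α ⟨i, s⟩) = (X ^ c * (μ u).1).eval (α ⟨i, s⟩) := by
      intro u
      let S := eᶜ.sigma fun i => (Finset.univ : Finset (Fin (k i)))
      let Q := Lagrange.interpolate S α fun x => (X ^ c * (μ u).1).eval (α x)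
      have hQ : Q ∈ degreeLT (ZMod p) c := by
        refine mem_degreeLT.2 ((Lagrange.degree_interpolate_lt _ α.injective.injOn).trans_le ?_)
        rw [Finset.card_sigma]
        simp only [Finset.card_univ, Fintype.card_fin]
        exact_mod_cast hout e he
      refine ⟨ν.symm ⟨Q, hQ⟩, fun i hi s => ?_⟩
      rw [LinearEquiv.apply_symm_apply]
      exact Lagrange.eval_interpolate_at_node _ α.injective.injOn (by simp [S, hi])
    choose t ht using hex
    refine ⟨fun u => Equiv.subRight (t u), fun u u' v i hi => ?_⟩
    have key : ∀ u, g u (Equiv.subRight (t u) v) i = ε i fun s => (ν v).1.eval (α ⟨i, s⟩) := by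
      intro u
      refine congrArg (ε i) (funext fun s => ?_)
      simp only [P, Equiv.subRight_apply, map_sub, Submodule.coe_sub, eval_add, eval_sub, ht u i hi]
      ring
    rw [key, key]

/-! ### The capacity of the MDS graph. -/

theorem Fin.card_filter_val_lt_of_le {N s : ℕ} (h : s ≤ N) :
    (Finset.univ.filter fun i : Fin N => i.val < s).card = s := by
  rw [Fin.card_filter_val_lt, min_eq_right h]

/-- The least sum over `s` indices of a monotone function is the sum over the first `s`. -/
theorem Monotone.sum_filter_val_lt_le {N s : ℕ} {lam : Fin N → ℝ} (hmono : Monotone lam)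
    (h : s ≤ N) {I : Finset (Fin N)} (hI : I.card = s) :
    ∑ i with (i : Fin N).val < s, lam i ≤ ∑ i ∈ I, lam i := by
  rcases Nat.eq_zero_or_pos s with rfl | hs
  · simp [Finset.card_eq_zero.1 hI]
  let i₀ : Fin N := ⟨s - 1, by omega⟩
  -- Relative to the threshold `lam i₀`, the first `s` terms are `≤ 0` and the others `≥ 0`, so the
  -- comparison holds index by index.
  have h1 : ∑ i with (i : Fin N).val < s, (lam i - lam i₀) ≤ ∑ i ∈ I, (lam i - lam i₀) := by
    rw [Finset.sum_filter, ← Finset.filter_univ_mem I, Finset.sum_filter]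
    refine Finset.sum_le_sum fun i _ => ?_
    by_cases hi : i.val < s
    · have : lam i ≤ lam i₀ := hmono (Fin.le_def.2 (by simp only [i₀]; omega))
      rw [if_pos hi]
      split_ifs <;> linarith
    · have : lam i₀ ≤ lam i := hmono (Fin.le_def.2 (by simp only [i₀]; omega))
      rw [if_neg hi]
      split_ifs <;> linarith
  rw [Finset.sum_sub_distrib, Finset.sum_sub_distrib, Finset.sum_const, Finset.sum_const, hI,
    Fin.card_filter_val_lt_of_le h] at h1
  linarith

/-- The two decoding sets share the first `2K-N` nodes and split the remaining `2(N-K)` nodes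
equally. -/
theorem capacity_mdsGraph_le {N K : ℕ} (hKN : K ≤ N) (hK : N < 2 * K) (lam : Fin N → ℝ) :
    (mdsGraph lam K).capacity ≤ ((∑ i with (i : Fin N).val < 2 * K - N, lam i : ℝ) : EReal) := by
  refine iSup₂_le fun q hq => iSup₂_le fun κ hκ => sSup_le ?_
  rintro x ⟨l, rfl, m, hm, hlog, hfit⟩
  obtain ⟨d, hd, hbound⟩ := hfit.le_prod hm
  let e₁ : Finset (Fin N) := Finset.univ.filter fun i => i.val < K
  let e₂ : Finset (Fin N) := Finset.univ.filter fun i => i.val < 2 * K - N ∨ K ≤ i.val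
  have hunion : e₁ ∪ e₂ = Finset.univ := by
    ext i
    simp only [e₁, e₂, Finset.mem_union, Finset.mem_filter, Finset.mem_univ, true_and, iff_true]
    omega
  have hinter : e₁ ∩ e₂ = Finset.univ.filter fun i => i.val < 2 * K - N := by
    ext i
    simp only [e₁, e₂, Finset.mem_inter, Finset.mem_filter, Finset.mem_univ, true_and]
    omega
  have hc₁ : e₁.card = K := Fin.card_filter_val_lt_of_le hKN
  have hc₂ : e₂.card = K := by
    have h1 := Finset.card_union_add_card_inter e₁ e₂
    rw [hunion, hinter, Fin.card_filter_val_lt_of_le (by omega), hc₁, Finset.card_univ,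
      Fintype.card_fin] at h1
    omega
  have h1 := hbound e₁ hc₁ e₂ hc₂ hunion
  rw [hinter] at h1
  have hq1 : (1 : ℝ) < q := by exact_mod_cast hq
  have hκ0 : (0 : ℝ) < κ := by exact_mod_cast hκ
  have h2 : Real.logb q m ≤ κ * ∑ i with (i : Fin N).val < 2 * K - N, lam i := by
    calc Real.logb q m ≤ Real.logb q (∏ i with (i : Fin N).val < 2 * K - N, (d i : ℝ)) :=
          Real.logb_le_logb_of_le hq1 (by exact_mod_cast hm) (by exact_mod_cast h1)
      _ = ∑ i with (i : Fin N).val < 2 * K - N, Real.logb q (d i) :=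
          Real.logb_prod _ _ fun i _ => by exact_mod_cast (hd i).1.ne'
      _ ≤ ∑ i with (i : Fin N).val < 2 * K - N, κ * lam i :=
          Finset.sum_le_sum fun i _ => (hd i).2
      _ = _ := (Finset.mul_sum _ _ _).symm
  rw [hlog] at h2
  exact EReal.coe_le_coe_iff.2 (le_of_mul_le_mul_left h2 hκ0)

theorem le_capacity_mdsGraph {N K : ℕ} (hKN : K ≤ N) (hK : N < 2 * K) (lam : Fin N → ℝ)
    (hlam : ∀ i, 0 ≤ lam i) (hmono : Monotone lam) :
    ((∑ i with (i : Fin N).val < 2 * K - N, lam i : ℝ) : EReal) ≤ (mdsGraph lam K).capacity := by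
  set L := ∑ i with (i : Fin N).val < 2 * K - N, lam i with hL
  have hlim : Filter.Tendsto (fun κ : ℕ => ((L - N / κ : ℝ) : EReal)) Filter.atTop
      (nhds (L : EReal)) := by
    refine (continuous_coe_real_ereal.tendsto _).comp ?_
    simpa using tendsto_const_nhds.sub (tendsto_const_div_atTop_nhds_zero_nat (N : ℝ))
  refine le_of_tendsto hlim (Filter.eventually_atTop.2 ⟨1, fun κ hκ => ?_⟩)
  have hκ0 : (0 : ℝ) < κ := by exact_mod_cast hκ
  let i₀ : Fin N := ⟨2 * K - N - 1, by omega⟩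
  -- The cap at `i₀`, the last of the first `2K-N` nodes, ensures that any `N-K` nodes hold at most
  -- `(N-K)t` symbols, which is the amount of noise used. As the total is `a + 2(N-K)t`, any `K`
  -- nodes keep at least `a + (N-K)t`.
  let k : Fin N → ℕ := fun i => ⌊κ * lam (min i i₀)⌋₊
  let t : ℕ := ⌊κ * lam i₀⌋₊
  let a : ℕ := ∑ i with (i : Fin N).val < 2 * K - N, k i
  have hkt : ∀ i, k i ≤ t := fun i => Nat.floor_le_floor
    (mul_le_mul_of_nonneg_left (hmono (min_le_right _ _)) hκ0.le)
  have hlow : ∀ i : Fin N, i.val < 2 * K - N → k i = ⌊κ * lam i⌋₊ := fun i hi => by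
    simp only [k]
    rw [min_eq_left (Fin.le_def.2 (by simp only [i₀]; omega))]
  have hhigh : ∀ i : Fin N, ¬ i.val < 2 * K - N → k i = t := fun i hi => by
    simp only [k, t]
    rw [min_eq_right (Fin.le_def.2 (by simp only [i₀]; omega))]
  have htot : ∑ i, k i = a + (2 * (N - K)) * t := by
    rw [← Finset.sum_filter_add_sum_filter_not Finset.univ fun i : Fin N => i.val < 2 * K - N]
    congr 1
    rw [Finset.sum_congr rfl fun i hi => hhigh i (Finset.mem_filter.1 hi).2, Finset.sum_const,
      smul_eq_mul]
    congr 1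
    have h1 := Finset.card_filter_add_card_filter_not (s := (Finset.univ : Finset (Fin N)))
      (fun i : Fin N => i.val < 2 * K - N)
    rw [Fin.card_filter_val_lt_of_le (by omega), Finset.card_univ, Fintype.card_fin] at h1
    omega
  have hout : ∀ e ∈ (mdsGraph lam K).edges, ∑ i ∈ eᶜ, k i ≤ (N - K) * t := by
    intro e he
    have he' : e.card = K := he
    refine (Finset.sum_le_card_nsmul _ _ t fun i _ => hkt i).trans_eq ?_
    rw [Finset.card_compl, he', Fintype.card_fin, smul_eq_mul]
  -- The field needs one evaluation point per stored symbol; `p` may grow with `κ` because the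
  -- capacity is also a supremum over `q`.
  obtain ⟨p, hp, hprime⟩ := Nat.exists_infinite_primes (∑ i, k i)
  have : Fact p.Prime := ⟨hprime⟩
  have hfit : (mdsGraph lam K).Fits p κ (p ^ a) := by
    refine StorageGraph.fits_reedSolomon k a ((N - K) * t) hp (fun i => ?_) ?_ (fun e he => ?_) hout
    · refine (Nat.floor_le (mul_nonneg hκ0.le (hlam _))).trans ?_
      exact mul_le_mul_of_nonneg_left (hmono (min_le_left _ _)) hκ0.le
    · rw [htot, mul_assoc]
      omega
    · have h1 := hout e he
      have h2 := Finset.sum_add_sum_compl e k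
      rw [htot, mul_assoc] at h2
      omega
  have ha : κ * (L - N / κ) ≤ (a : ℝ) := by
    have h1 : ∑ i with (i : Fin N).val < 2 * K - N, (κ * lam i - 1) ≤ (a : ℝ) := by
      simp only [a, Nat.cast_sum]
      refine Finset.sum_le_sum fun i hi => ?_
      rw [hlow i (Finset.mem_filter.1 hi).2]
      exact (Nat.sub_one_lt_floor _).le
    rw [Finset.sum_sub_distrib, ← Finset.mul_sum, Finset.sum_const,
      Fin.card_filter_val_lt_of_le (by omega), nsmul_eq_mul, mul_one, ← hL] at h1
    have h2 : ((2 * K - N : ℕ) : ℝ) ≤ N := by exact_mod_cast (by omega : 2 * K - N ≤ N)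
    have h3 : κ * (L - N / κ) = κ * L - N := by field_simp
    linarith
  have h1 : (((a / κ : ℝ)) : EReal) ≤ (mdsGraph lam K).capacity := by
    refine le_iSup₂_of_le p hprime.two_le (le_iSup₂_of_le κ hκ (le_sSup ⟨a / κ, rfl, p ^ a,
      Nat.pow_pos hprime.pos, ?_, hfit⟩))
    rw [Nat.cast_pow, Real.logb_pow, Real.logb_self_eq_one (by exact_mod_cast hprime.one_lt),
      mul_one, mul_div_cancel₀ _ hκ0.ne']
  refine le_trans (EReal.coe_le_coe_iff.2 ?_) h1
  rw [le_div_iff₀ hκ0]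
  linarith

theorem theorem3 (N K : ℕ) (hKN : K ≤ N) (hK : N < 2 * K)
    (lam : Fin N → ℝ) (hlam : ∀ i, 0 ≤ lam i) (hmono : Monotone lam) :
    (mdsGraph lam K).capacity =
        ((∑ i with (i : Fin N).val < 2 * K - N, lam i : ℝ) : EReal) ∧
      IsLeast ((mdsGraph lam K).totalSize '' {I : Finset (Fin N) | I.card = 2 * K - N})
        (∑ i with (i : Fin N).val < 2 * K - N, lam i) ∧
      (mdsGraph (fun _ : Fin N => 1) K).capacity = (((2 * K - N : ℕ) : ℝ) : EReal) := by
  refine ⟨(capacity_mdsGraph_le hKN hK lam).antisymm (le_capacity_mdsGraph hKN hK lam hlam hmono),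
    ⟨⟨_, Fin.card_filter_val_lt_of_le (by omega), rfl⟩, ?_⟩, ?_⟩
  · rintro _ ⟨I, hI, rfl⟩
    exact hmono.sum_filter_val_lt_le (by omega) hI
  · rw [(capacity_mdsGraph_le hKN hK fun _ => 1).antisymm
      (le_capacity_mdsGraph hKN hK (fun _ => 1) (fun _ => zero_le_one) monotone_const)]
    simp [Finset.sum_const, Fin.card_filter_val_lt_of_le (show 2 * K - N ≤ N by omega)]
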